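/- Let $\alpha,\beta>-1$ be real and let $w(x)=(1-x)^{\alpha}(1+x)^{\beta}$ be the Jacobi weight on $[-1,1]$. There is exactly one sequence $(P_n)_{n\ge 0}$ of real polynomials such that $P_n$ is monic of degree $n$ and $$\int_{-1}^{1}P_m(x)P_n(x)w(x)\,dx=h_n\delta_{m,n}\qquad(m,n\ge 0)$$ with $h_n>0$ (the monic Jacobi polynomials). They satisfy a recurrence relation $$xP_n(x)=P_{n+1}(x)+\alpha_nP_n(x)+\beta_nP_{n-1}(x),\qquad n=0,1,2,\dots,$$ where $\beta_0P_{-1}:=0$, with real $\alpha_n$ $(n\ge 0)$ and $\beta_n>0$ $(n\ge1)$. The diagonal coefficients are $$\alpha_n=\frac{\beta^2-\alpha^2}{(\alpha+\beta+2n)(\alpha+\beta+2n+2)}$$ for every $n\ge 0$, except when $n=0$ and $\alpha+\beta=0$, where the right-hand side is $0/0$; for $n=0$ one has, in all cases, $\alpha_0=\dfrac{\beta-\alpha}{\alpha+\beta+2}$. -/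

import Mathlib

open Polynomial MeasureTheory

/-- The Jacobi weight `(1 - x) ^ α * (1 + x) ^ β`, used on `[-1, 1]`. -/
noncomputable def jacobiWeight (α β x : ℝ) : ℝ := (1 - x) ^ α * (1 + x) ^ β

/-- `P` is the sequence of monic orthogonal polynomials for the weight `w` on `[a, b]`:
`P n` is monic of degree `n`, the integrals of `P m * P n * w` exist, they vanish for `m ≠ n`,
and the squared norms `h n`, which are the integrals of `P n ^ 2 * w`, are positive. -/
structure IsMonicOrthogonal (w : ℝ → ℝ) (a b : ℝ) (P : ℕ → ℝ[X]) : Prop where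
  monic : ∀ n, (P n).Monic
  natDegree_eq : ∀ n, (P n).natDegree = n
  integrable : ∀ m n, IntervalIntegrable (fun x => (P m).eval x * (P n).eval x * w x) volume a b
  orthogonal : ∀ m n, m ≠ n → ∫ x in a..b, (P m).eval x * (P n).eval x * w x = 0
  normSq_pos : ∀ n, 0 < ∫ x in a..b, (P n).eval x * (P n).eval x * w x

/-- `A n` and `B n` are the coefficients of the three-term recurrence
`X * P n = P (n + 1) + A n * P n + B n * P (n - 1)`, where the last term is absent for `n = 0`
(so `B 0` plays no role). -/
structure IsRecurrenceCoeffs (P : ℕ → ℝ[X]) (A B : ℕ → ℝ) : Prop where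
  zero : X * P 0 = P 1 + C (A 0) * P 0
  succ : ∀ n, X * P (n + 1) = P (n + 2) + C (A (n + 1)) * P (n + 1) + C (B (n + 1)) * P n

/-! ### Orthogonal polynomials for a positive definite functional -/

section PositiveFunctional

variable {L : ℝ[X] →ₗ[ℝ] ℝ}

/-! Comparing subleading coefficients in the recurrence gives `A n = σ n - σ (n + 1)`, with `σ n`
the coefficient of `X ^ (n - 1)` in `P n` and `σ 0 = 0`. The Jacobi differential equation supplies
`σ`: by the Pearson identity `((1 - x²) w)' = (β - α - (α + β + 2) x) w` the operator is symmetric,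
and it does not raise degrees, so each `P n` is an eigenvector. Its next coefficient then gives `σ n
= n (α - β) / (α + β + 2 n)`. The algebra uses only a positive functional `L`; the weight enters
through positivity (`jacobiFunctional_mul_self_pos`) and `jacobiFunctional_pearson`. -/

theorem eq_zero_of_orthogonal_degree_lt (hL : ∀ p : ℝ[X], p ≠ 0 → 0 < L (p * p)) {n : ℕ}
    {p : ℝ[X]} (hp : p.degree < n) (h : ∀ q : ℝ[X], q.degree < n → L (p * q) = 0) : p = 0 := by
  by_contra hne
  exact (hL p hne).ne' (h p hp)

/-- The Gram form on polynomials of degree below `n` is definite, hence identifies that space with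
its dual; subtract from `X ^ n` the representative of `q ↦ L (X ^ n * q)`. -/
theorem exists_monic_orthogonal_degree_lt (hL : ∀ p : ℝ[X], p ≠ 0 → 0 < L (p * p)) (n : ℕ) :
    ∃ p : ℝ[X], p.Monic ∧ p.natDegree = n ∧ ∀ q : ℝ[X], q.degree < n → L (p * q) = 0 := by
  let T : degreeLT ℝ n →ₗ[ℝ] Module.Dual ℝ (degreeLT ℝ n) :=
    ((LinearMap.mul ℝ ℝ[X]).compr₂ L).domRestrict₁₂ (degreeLT ℝ n) (degreeLT ℝ n)
  have hT : ∀ p q, T p q = L (p.1 * q.1) := fun p q => rfl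
  have : FiniteDimensional ℝ (degreeLT ℝ n) :=
    Module.Finite.equiv (degreeLTEquiv ℝ n).symm
  have hinj : Function.Injective T := by
    rw [injective_iff_map_eq_zero]
    intro p hp
    by_contra hne
    have := hL p.1 (fun h => hne (Subtype.ext h))
    rw [← hT, hp] at this
    simp at this
  have hsurj : Function.Surjective T :=
    (LinearMap.injective_iff_surjective_of_finrank_eq_finrank
      (Subspace.dual_finrank_eq).symm).1 hinj
  obtain ⟨q, hq⟩ := hsurj ((L ∘ₗ LinearMap.mulLeft ℝ (X ^ n)) ∘ₗ (degreeLT ℝ n).subtype)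
  have hqn : q.1.degree < n := mem_degreeLT.1 q.2
  have hqX : q.1.degree < (X ^ n : ℝ[X]).degree := by simpa using hqn
  refine ⟨X ^ n - q.1, ?_, ?_, ?_⟩
  · exact (monic_X_pow n).sub_of_left hqX
  · rw [natDegree_eq_of_degree_eq (degree_sub_eq_left_of_degree_lt hqX), natDegree_X_pow]
  · intro r hr
    have := LinearMap.congr_fun hq ⟨r, mem_degreeLT.2 hr⟩
    rw [hT] at this
    rw [sub_mul, map_sub, this]
    simp

theorem degree_sub_C_coeff_mul_lt {p q : ℝ[X]} {n : ℕ} (hp : p.Monic) (hpn : p.natDegree = n)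
    (hq : q.degree < (n + 1 : ℕ)) : (q - C (q.coeff n) * p).degree < n := by
  rw [degree_lt_iff_coeff_zero] at hq ⊢
  intro m hm
  rw [coeff_sub, coeff_C_mul]
  rcases hm.eq_or_lt with rfl | hlt
  · have : p.coeff n = 1 := by rw [← hpn]; exact hp
    simp [this]
  · rw [hq m hlt, coeff_eq_zero_of_natDegree_lt (hpn.trans_lt hlt)]
    simp

theorem orthogonal_degree_lt_of_pairwise {P : ℕ → ℝ[X]} (hm : ∀ n, (P n).Monic)
    (hd : ∀ n, (P n).natDegree = n) (ho : ∀ m n, m ≠ n → L (P m * P n) = 0) (n : ℕ) (q : ℝ[X])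
    (hq : q.degree < n) : L (P n * q) = 0 := by
  suffices H : ∀ m ≤ n, ∀ q : ℝ[X], q.degree < m → L (P n * q) = 0 from H n le_rfl q hq
  intro m
  induction m with
  | zero =>
    intro _ q hq
    have : q = 0 := by simpa using hq
    simp [this]
  | succ m ih =>
    intro hmn q hq
    have h := ih (by omega) _ (degree_sub_C_coeff_mul_lt (hm m) (hd m) hq)
    have : P n * (q - C (q.coeff m) * P m) = P n * q - q.coeff m • (P n * P m) := by
      rw [smul_eq_C_mul]; ring
    rw [this, map_sub, map_smul, ho n m (by omega)] at h
    simpa using h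

theorem eq_of_monic_orthogonal_degree_lt (hL : ∀ p : ℝ[X], p ≠ 0 → 0 < L (p * p)) {n : ℕ}
    {p q : ℝ[X]} (hp : p.Monic) (hpn : p.natDegree = n) (hq : q.Monic) (hqn : q.natDegree = n)
    (hpo : ∀ r : ℝ[X], r.degree < n → L (p * r) = 0)
    (hqo : ∀ r : ℝ[X], r.degree < n → L (q * r) = 0) : p = q := by
  refine sub_eq_zero.1 (eq_zero_of_orthogonal_degree_lt hL (n := n) ?_ ?_)
  · have hc : p.coeff n = 1 := by rw [← hpn]; exact hp
    have := degree_sub_C_coeff_mul_lt (q := p) hq hqn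
      (by rw [← hpn]; exact degree_lt_iff_coeff_zero _ _ |>.2 fun m hm =>
            coeff_eq_zero_of_natDegree_lt (by omega))
    simpa [hc] using this
  · intro r hr
    rw [sub_mul, map_sub, hpo r hr, hqo r hr, sub_zero]

theorem degree_lt_succ_of_natDegree_eq {p : ℝ[X]} {n : ℕ} (h : p.natDegree = n) :
    p.degree < (n + 1 : ℕ) :=
  lt_of_le_of_lt degree_le_natDegree (by rw [h]; exact_mod_cast n.lt_succ_self)

theorem degree_X_mul_lt {q : ℝ[X]} {n : ℕ} (hq : q.degree < n) :
    (X * q).degree < ((n + 1 : ℕ) : WithBot ℕ) := by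
  rw [degree_lt_iff_coeff_zero] at hq ⊢
  rintro (_ | m) hm
  · omega
  · rw [coeff_X_mul]; exact hq m (by omega)

theorem degree_X_mul_sub_lt {P : ℕ → ℝ[X]} (hm : ∀ n, (P n).Monic)
    (hd : ∀ n, (P n).natDegree = n) (n : ℕ) :
    (X * P n - P (n + 1)).degree < ((n + 1 : ℕ) : WithBot ℕ) := by
  have h := degree_sub_C_coeff_mul_lt (hm (n + 1)) (hd (n + 1))
    (degree_X_mul_lt (degree_lt_succ_of_natDegree_eq (hd n)))
  have hc : (P n).coeff n = 1 := by simpa [hd] using (hm n).coeff_natDegree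
  simpa [coeff_X_mul, hc] using h

theorem exists_three_term_recurrence (hL : ∀ p : ℝ[X], p ≠ 0 → 0 < L (p * p)) {P : ℕ → ℝ[X]}
    (hm : ∀ n, (P n).Monic) (hd : ∀ n, (P n).natDegree = n)
    (hlow : ∀ (n : ℕ) (q : ℝ[X]), q.degree < n → L (P n * q) = 0) (n : ℕ) :
    ∃ a b : ℝ, X * P (n + 1) = P (n + 2) + C a * P (n + 1) + C b * P n := by
  obtain ⟨R, hR⟩ : ∃ R, R = X * P (n + 1) - P (n + 2) := ⟨_, rfl⟩
  have h0 : R.degree < ((n + 1 + 1 : ℕ) : WithBot ℕ) := hR ▸ degree_X_mul_sub_lt hm hd (n + 1)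
  obtain ⟨a, h1⟩ : ∃ a, (R - C a * P (n + 1)).degree < ((n + 1 : ℕ) : WithBot ℕ) :=
    ⟨_, degree_sub_C_coeff_mul_lt (hm _) (hd _) h0⟩
  obtain ⟨b, h2⟩ : ∃ b, (R - C a * P (n + 1) - C b * P n).degree < (n : WithBot ℕ) :=
    ⟨_, degree_sub_C_coeff_mul_lt (hm _) (hd _) h1⟩
  have h3 : R - C a * P (n + 1) - C b * P n = 0 := by
    -- Moving `X` onto `q` raises its degree to at most `n`, still below that of `P (n + 1)`.
    refine eq_zero_of_orthogonal_degree_lt hL h2 fun q hq => ?_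
    have e : (R - C a * P (n + 1) - C b * P n) * q =
        P (n + 1) * (X * q) - P (n + 2) * q - a • (P (n + 1) * q) - b • (P n * q) := by
      simp only [smul_eq_C_mul, hR]; ring
    have hq1 : q.degree < (n + 1 : ℕ) := hq.trans (by exact_mod_cast n.lt_succ_self)
    have hq2 : q.degree < (n + 2 : ℕ) := hq.trans (by exact_mod_cast (by omega : n < n + 2))
    rw [e, map_sub, map_sub, map_sub, map_smul, map_smul, hlow _ _ hq, hlow _ _ hq1, hlow _ _ hq2,
      hlow _ _ (degree_X_mul_lt hq)]
    simp
  exact ⟨a, b, by linear_combination h3 - hR⟩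

/-- Pairing the recurrence with `P n` gives `b * L (P n ^ 2) = L (P (n + 1) ^ 2)`. -/
theorem recurrence_coeff_pos (hL : ∀ p : ℝ[X], p ≠ 0 → 0 < L (p * p)) {P : ℕ → ℝ[X]}
    (hm : ∀ n, (P n).Monic) (hd : ∀ n, (P n).natDegree = n)
    (ho : ∀ m n, m ≠ n → L (P m * P n) = 0) {n : ℕ} {a b : ℝ}
    (h : X * P (n + 1) = P (n + 2) + C a * P (n + 1) + C b * P n) : 0 < b := by
  have h1 : L (X * P (n + 1) * P n) = L (P (n + 1) * P (n + 1)) := by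
    have := orthogonal_degree_lt_of_pairwise hm hd ho (n + 1) _ (degree_X_mul_sub_lt hm hd n)
    rw [mul_sub, map_sub, sub_eq_zero] at this
    rw [← this, mul_left_comm, mul_assoc]
  have e : X * P (n + 1) * P n = P (n + 2) * P n + a • (P (n + 1) * P n) + b • (P n * P n) := by
    simp only [smul_eq_C_mul]; rw [h]; ring
  rw [e, map_add, map_add, map_smul, map_smul, ho _ _ (by omega), ho _ _ (by omega), smul_zero,
    zero_add, zero_add, smul_eq_mul] at h1
  exact pos_of_mul_pos_left (h1 ▸ hL _ (hm (n + 1)).ne_zero) (hL _ (hm n).ne_zero).le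

theorem exists_isRecurrenceCoeffs (hL : ∀ p : ℝ[X], p ≠ 0 → 0 < L (p * p)) {P : ℕ → ℝ[X]}
    (hm : ∀ n, (P n).Monic) (hd : ∀ n, (P n).natDegree = n)
    (ho : ∀ m n, m ≠ n → L (P m * P n) = 0) :
    ∃ A B : ℕ → ℝ, IsRecurrenceCoeffs P A B ∧ ∀ n, 1 ≤ n → 0 < B n := by
  choose a b hab using
    exists_three_term_recurrence hL hm hd (orthogonal_degree_lt_of_pairwise hm hd ho)
  obtain ⟨c, hc⟩ : ∃ c : ℝ, X * P 0 - P 1 = C c * P 0 := by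
    have h := degree_sub_C_coeff_mul_lt (hm 0) (hd 0) (degree_X_mul_sub_lt hm hd 0)
    rw [Nat.cast_zero, Nat.WithBot.lt_zero_iff, degree_eq_bot] at h
    exact ⟨_, sub_eq_zero.1 h⟩
  refine ⟨fun n => if n = 0 then c else a (n - 1), fun n => b (n - 1), ⟨?_, fun n => ?_⟩, ?_⟩
  · simp only [if_true]
    linear_combination hc
  · simpa using hab n
  · rintro (_ | n) hn
    · omega
    · exact recurrence_coeff_pos hL hm hd ho (hab n)

theorem coeff_eq_of_isRecurrenceCoeffs {P : ℕ → ℝ[X]} (hm : ∀ n, (P n).Monic)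
    (hd : ∀ n, (P n).natDegree = n) {A B : ℕ → ℝ} (h : IsRecurrenceCoeffs P A B) :
    A 0 = -(P 1).coeff 0 ∧ ∀ n, A (n + 1) = (P (n + 1)).coeff n - (P (n + 2)).coeff (n + 1) := by
  have hc : ∀ n, (P n).coeff n = 1 := fun n => by simpa [hd] using (hm n).coeff_natDegree
  constructor
  · have := congrArg (fun p => p.coeff 0) h.zero
    simp [hc] at this
    linarith
  · intro n
    have := congrArg (fun p => p.coeff (n + 1)) (h.succ n)
    simp [hc, coeff_X_mul, coeff_eq_zero_of_natDegree_lt (p := P n) (n := n + 1) (by simp [hd])]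
      at this
    linarith

end PositiveFunctional

/-! ### The differential equation and the subleading coefficient -/

section JacobiOperator

/-- The Jacobi differential operator `(1 - x²) p'' + (β - α - (α + β + 2) x) p'`. -/
noncomputable def jacobiOperator (α β : ℝ) (p : ℝ[X]) : ℝ[X] :=
  (1 - X ^ 2) * derivative (derivative p) +
    (C (β - α) - C (α + β + 2) * X) * derivative p

theorem coeff_jacobiOperator (α β : ℝ) (p : ℝ[X]) (n : ℕ) :
    (jacobiOperator α β p).coeff n =
      (n + 2) * (n + 1) * p.coeff (n + 2) + (β - α) * (n + 1) * p.coeff (n + 1) -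
        n * (n + α + β + 1) * p.coeff n := by
  have e : jacobiOperator α β p = derivative (derivative p) -
      X * (X * derivative (derivative p)) + C (β - α) * derivative p -
      C (α + β + 2) * (X * derivative p) := by
    unfold jacobiOperator; ring
  rw [e]
  rcases n with _ | _ | n <;>
    simp only [coeff_add, coeff_sub, coeff_C_mul, coeff_X_mul, coeff_derivative,
      mul_coeff_zero, coeff_X_zero, coeff_C_zero] <;> push_cast <;> ring

theorem degree_jacobiOperator_lt {α β : ℝ} {p : ℝ[X]} {n : ℕ} (hp : p.degree < n) :
    (jacobiOperator α β p).degree < n := by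
  rw [degree_lt_iff_coeff_zero] at hp ⊢
  intro m hm
  rw [coeff_jacobiOperator, hp _ hm, hp _ (by omega), hp _ (by omega)]
  ring

variable {L : ℝ[X] →ₗ[ℝ] ℝ} {α β : ℝ}

/-- Apply `hP` to `p' q` and `p q'` and subtract: the `p' q'` terms cancel. -/
theorem jacobiOperator_symmetric
    (hP : ∀ p : ℝ[X], L ((1 - X ^ 2) * derivative p +
      (C (β - α) - C (α + β + 2) * X) * p) = 0) (p q : ℝ[X]) :
    L (jacobiOperator α β p * q) = L (p * jacobiOperator α β q) := by
  have h1 := hP (derivative p * q)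
  have h2 := hP (p * derivative q)
  have h := (map_sub L _ _).trans (congrArg₂ (· - ·) h1 h2)
  simp only [derivative_mul, sub_zero] at h
  rw [← sub_eq_zero, ← map_sub, ← h]
  congr 1
  unfold jacobiOperator
  ring

theorem jacobiOperator_eq (hL : ∀ p : ℝ[X], p ≠ 0 → 0 < L (p * p))
    (hP : ∀ p : ℝ[X], L ((1 - X ^ 2) * derivative p +
      (C (β - α) - C (α + β + 2) * X) * p) = 0) {n : ℕ} {p : ℝ[X]} (hm : p.Monic)
    (hd : p.natDegree = n) (ho : ∀ q : ℝ[X], q.degree < n → L (p * q) = 0) :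
    jacobiOperator α β p = C (-(n * (n + α + β + 1))) * p := by
  have hp := degree_lt_succ_of_natDegree_eq hd
  have hc : p.coeff n = 1 := by rw [← hd]; exact hm
  have hlt := degree_sub_C_coeff_mul_lt hm hd (degree_jacobiOperator_lt (α := α) (β := β) hp)
  have hcoeff : (jacobiOperator α β p).coeff n = -(n * (n + α + β + 1)) := by
    rw [coeff_jacobiOperator, hc, coeff_eq_zero_of_natDegree_lt (n := n + 2) (by omega),
      coeff_eq_zero_of_natDegree_lt (n := n + 1) (by omega)]
    ring
  rw [hcoeff] at hlt
  refine sub_eq_zero.1 (eq_zero_of_orthogonal_degree_lt hL hlt fun q hq => ?_)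
  rw [sub_mul, map_sub, jacobiOperator_symmetric hP, ho _ (degree_jacobiOperator_lt hq), mul_assoc,
    ← smul_eq_C_mul, map_smul, ho _ hq]
  simp

/-- The factor on the left is the gap between the diagonal entries of the operator at degrees `n +
1` and `n`. -/
theorem subleading_coeff_eq (hL : ∀ p : ℝ[X], p ≠ 0 → 0 < L (p * p))
    (hP : ∀ p : ℝ[X], L ((1 - X ^ 2) * derivative p +
      (C (β - α) - C (α + β + 2) * X) * p) = 0) {n : ℕ} {p : ℝ[X]} (hm : p.Monic)
    (hd : p.natDegree = n + 1) (ho : ∀ q : ℝ[X], q.degree < (n + 1 : ℕ) → L (p * q) = 0) :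
    (α + β + 2 * (n + 1)) * p.coeff n = (n + 1) * (α - β) := by
  have hc : p.coeff (n + 1) = 1 := by rw [← hd]; exact hm
  have h := congrArg (fun q => q.coeff n) (jacobiOperator_eq hL hP hm hd ho)
  simp only [coeff_jacobiOperator, coeff_C_mul, hc,
    coeff_eq_zero_of_natDegree_lt (p := p) (n := n + 2) (by omega)] at h
  push_cast at h
  linear_combination h

end JacobiOperator

/-! ### Positivity and the Pearson identity for the Jacobi weight -/

section JacobiWeight

variable {α β : ℝ}

theorem intervalIntegrable_jacobiWeight (hα : -1 < α) (hβ : -1 < β) :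
    IntervalIntegrable (jacobiWeight α β) volume (-1) 1 := by
  -- Splitting at `0` leaves one possibly singular factor on each half.
  have h1 : IntervalIntegrable (fun x : ℝ => (1 + x) ^ β) volume (-1) 0 := by
    simpa using (intervalIntegral.intervalIntegrable_rpow' (a := 0) (b := 1) hβ).comp_add_left 1
  have h2 : IntervalIntegrable (fun x : ℝ => (1 - x) ^ α) volume 0 1 := by
    simpa using (intervalIntegral.intervalIntegrable_rpow' (a := 1) (b := 0) hα).comp_sub_left 1
  have c1 : ContinuousOn (fun x : ℝ => (1 - x) ^ α) (Set.uIcc (-1) 0) := by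
    refine ContinuousOn.rpow_const (by fun_prop) fun x hx => Or.inl ?_
    rw [Set.uIcc_of_le (by norm_num)] at hx
    linarith [hx.2]
  have c2 : ContinuousOn (fun x : ℝ => (1 + x) ^ β) (Set.uIcc 0 1) := by
    refine ContinuousOn.rpow_const (by fun_prop) fun x hx => Or.inl ?_
    rw [Set.uIcc_of_le (by norm_num)] at hx
    linarith [hx.1]
  exact (h1.continuousOn_mul c1).trans (h2.mul_continuousOn c2)

theorem intervalIntegrable_eval_mul_jacobiWeight (hα : -1 < α) (hβ : -1 < β) (p : ℝ[X]) :
    IntervalIntegrable (fun x => p.eval x * jacobiWeight α β x) volume (-1) 1 :=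
  (intervalIntegrable_jacobiWeight hα hβ).continuousOn_mul p.continuous.continuousOn

/-- Integration of polynomials against the Jacobi weight. -/
noncomputable def jacobiFunctional (hα : -1 < α) (hβ : -1 < β) : ℝ[X] →ₗ[ℝ] ℝ where
  toFun p := ∫ x in (-1 : ℝ)..1, p.eval x * jacobiWeight α β x
  map_add' p q := by
    rw [← intervalIntegral.integral_add (intervalIntegrable_eval_mul_jacobiWeight hα hβ p)
      (intervalIntegrable_eval_mul_jacobiWeight hα hβ q)]
    simp only [eval_add, add_mul]
  map_smul' c p := by
    rw [RingHom.id_apply, smul_eq_mul, ← intervalIntegral.integral_const_mul]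
    simp only [eval_smul, smul_eq_mul, mul_assoc]

theorem jacobiFunctional_apply (hα : -1 < α) (hβ : -1 < β) (p : ℝ[X]) :
    jacobiFunctional hα hβ p = ∫ x in (-1 : ℝ)..1, p.eval x * jacobiWeight α β x := rfl

theorem jacobiFunctional_mul (hα : -1 < α) (hβ : -1 < β) (p q : ℝ[X]) :
    jacobiFunctional hα hβ (p * q) =
      ∫ x in (-1 : ℝ)..1, p.eval x * q.eval x * jacobiWeight α β x := by
  simp only [jacobiFunctional_apply, eval_mul]

theorem jacobiWeight_pos {x : ℝ} (hx : x ∈ Set.Ioo (-1 : ℝ) 1) : 0 < jacobiWeight α β x :=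
  mul_pos (Real.rpow_pos_of_pos (by linarith [hx.2]) _)
    (Real.rpow_pos_of_pos (by linarith [hx.1]) _)

theorem jacobiFunctional_mul_self_pos (hα : -1 < α) (hβ : -1 < β) (p : ℝ[X]) (hp : p ≠ 0) :
    0 < jacobiFunctional hα hβ (p * p) := by
  rw [jacobiFunctional_apply, intervalIntegral.integral_of_le (by norm_num),
    integral_Ioc_eq_integral_Ioo]
  have hint : IntegrableOn (fun x => (p * p).eval x * jacobiWeight α β x) (Set.Ioo (-1) 1) := by
    have := intervalIntegrable_eval_mul_jacobiWeight hα hβ (p * p)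
    rwa [intervalIntegrable_iff_integrableOn_Ioo_of_le (by norm_num)] at this
  have hnn : ∀ x ∈ Set.Ioo (-1 : ℝ) 1, 0 ≤ (p * p).eval x * jacobiWeight α β x := fun x hx => by
    rw [eval_mul]
    exact mul_nonneg (mul_self_nonneg _) (jacobiWeight_pos hx).le
  rw [setIntegral_pos_iff_support_of_nonneg_ae
    ((ae_restrict_mem measurableSet_Ioo).mono hnn) hint]
  have hsub : Set.Ioo (-1 : ℝ) 1 \ {x | p.IsRoot x} ⊆
      Function.support (fun x => (p * p).eval x * jacobiWeight α β x) ∩ Set.Ioo (-1) 1 := by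
    rintro x ⟨hx, hr⟩
    refine ⟨?_, hx⟩
    rw [Function.mem_support, eval_mul]
    exact mul_ne_zero (mul_self_ne_zero.2 hr) (jacobiWeight_pos hx).ne'
  refine lt_of_lt_of_le ?_ (measure_mono hsub)
  rw [measure_sdiff_null ((finite_setOfPred_isRoot hp).measure_zero volume)]
  simp

/-- The integrand is the derivative of `(1 - x²) w p`, which vanishes at both endpoints because `α +
1` and `β + 1` are positive. -/
theorem jacobiFunctional_pearson (hα : -1 < α) (hβ : -1 < β) (p : ℝ[X]) :
    jacobiFunctional hα hβ ((1 - X ^ 2) * derivative p +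
      (C (β - α) - C (α + β + 2) * X) * p) = 0 := by
  rw [jacobiFunctional_apply, intervalIntegral.integral_eq_sub_of_hasDerivAt_of_le (by norm_num)
    (f := fun x => (1 - x) ^ (α + 1) * (1 + x) ^ (β + 1) * p.eval x) ?_ ?_
    (intervalIntegrable_eval_mul_jacobiWeight hα hβ _)]
  · simp [Real.zero_rpow (by linarith : α + 1 ≠ 0), Real.zero_rpow (by linarith : β + 1 ≠ 0)]
  · refine ((ContinuousOn.rpow_const (by fun_prop) fun x _ => Or.inr (by linarith)).mul
      (ContinuousOn.rpow_const (by fun_prop) fun x _ => Or.inr (by linarith))).mul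
      p.continuous.continuousOn
  · intro x hx
    have hx1 : 0 < 1 - x := by linarith [hx.2]
    have hx2 : 0 < 1 + x := by linarith [hx.1]
    have d1 := ((hasDerivAt_id x).const_sub 1).rpow_const (p := α + 1) (Or.inl hx1.ne')
    have d2 := ((hasDerivAt_id x).const_add 1).rpow_const (p := β + 1) (Or.inl hx2.ne')
    have := (d1.mul d2).mul (p.hasDerivAt x)
    refine this.congr_deriv ?_
    simp only [id, add_sub_cancel_right, jacobiWeight, Real.rpow_add_one hx1.ne',
      Real.rpow_add_one hx2.ne', eval_add, eval_mul, eval_sub, eval_one, eval_pow, eval_X, eval_C,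
      Pi.mul_apply]
    ring

theorem isMonicOrthogonal_jacobiWeight_iff (hα : -1 < α) (hβ : -1 < β) (P : ℕ → ℝ[X]) :
    IsMonicOrthogonal (jacobiWeight α β) (-1) 1 P ↔
      (∀ n, (P n).Monic) ∧ (∀ n, (P n).natDegree = n) ∧
        ∀ (n : ℕ) (q : ℝ[X]), q.degree < n → jacobiFunctional hα hβ (P n * q) = 0 := by
  constructor
  · intro h
    refine ⟨h.monic, h.natDegree_eq,
      orthogonal_degree_lt_of_pairwise h.monic h.natDegree_eq fun m n hmn => ?_⟩
    rw [jacobiFunctional_mul]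
    exact h.orthogonal m n hmn
  · rintro ⟨hm, hd, ho⟩
    have hdeg : ∀ {m n}, m < n → (P m).degree < n := fun {m n} hmn =>
      lt_of_le_of_lt degree_le_natDegree (by rw [hd]; exact_mod_cast hmn)
    refine ⟨hm, hd, fun m n => ?_, fun m n hmn => ?_, fun n => ?_⟩
    · simpa only [eval_mul] using intervalIntegrable_eval_mul_jacobiWeight hα hβ (P m * P n)
    · rw [← jacobiFunctional_mul hα hβ]
      rcases hmn.lt_or_gt with h | h
      · rw [mul_comm]; exact ho _ _ (hdeg h)
      · exact ho _ _ (hdeg h)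
    · rw [← jacobiFunctional_mul hα hβ]
      exact jacobiFunctional_mul_self_pos hα hβ _ (hm n).ne_zero

end JacobiWeight

theorem mainTheorem1 (α β : ℝ) (hα : -1 < α) (hβ : -1 < β) :
    (∃! P : ℕ → ℝ[X], IsMonicOrthogonal (jacobiWeight α β) (-1) 1 P) ∧
    ∀ P : ℕ → ℝ[X], IsMonicOrthogonal (jacobiWeight α β) (-1) 1 P →
      (∃ A B : ℕ → ℝ, IsRecurrenceCoeffs P A B ∧ ∀ n, 1 ≤ n → 0 < B n) ∧
      ∀ A B : ℕ → ℝ, IsRecurrenceCoeffs P A B →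
        A 0 = (β - α) / (α + β + 2) ∧
        ∀ n : ℕ, (n ≠ 0 ∨ α + β ≠ 0) →
          A n = (β ^ 2 - α ^ 2) / ((α + β + 2 * n) * (α + β + 2 * n + 2)) := by
  have hL := jacobiFunctional_mul_self_pos hα hβ
  simp only [isMonicOrthogonal_jacobiWeight_iff hα hβ]
  refine ⟨?_, ?_⟩
  · choose P hm hd ho using exists_monic_orthogonal_degree_lt hL
    refine ⟨P, ⟨hm, hd, ho⟩, ?_⟩
    rintro Q ⟨hm', hd', ho'⟩
    funext n
    exact eq_of_monic_orthogonal_degree_lt hL (hm' n) (hd' n) (hm n) (hd n) (ho' n) (ho n)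
  rintro P ⟨hm, hd, ho⟩
  have hpair : ∀ m n, m ≠ n → jacobiFunctional hα hβ (P m * P n) = 0 := fun m n hmn => by
    rw [jacobiFunctional_mul]
    exact ((isMonicOrthogonal_jacobiWeight_iff hα hβ P).2 ⟨hm, hd, ho⟩).orthogonal m n hmn
  refine ⟨exists_isRecurrenceCoeffs hL hm hd hpair, fun A B hAB => ?_⟩
  obtain ⟨hA0, hA⟩ := coeff_eq_of_isRecurrenceCoeffs hm hd hAB
  have hpos : ∀ n : ℕ, 0 < α + β + 2 * (n + 1) := fun n => by
    have : (0 : ℝ) ≤ n := n.cast_nonneg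
    linarith
  have hσ : ∀ n : ℕ, (P (n + 1)).coeff n = (n + 1) * (α - β) / (α + β + 2 * (n + 1)) :=
    fun n => by
      rw [eq_div_iff (hpos n).ne', mul_comm]
      exact subleading_coeff_eq hL (jacobiFunctional_pearson hα hβ) (hm _) (hd _) (ho _)
  have h0 : A 0 = (β - α) / (α + β + 2) := by
    have := hσ 0
    simp only [Nat.cast_zero, zero_add, mul_one, one_mul] at this
    rw [hA0, this, ← neg_div, neg_sub]
  refine ⟨h0, ?_⟩
  rintro (_ | n) hn
  -- At index `0` the common factor `α + β` cancels.
  · have hs : α + β ≠ 0 := by simpa using hn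
    have h2 : α + β + 2 ≠ 0 := by linarith
    rw [h0, Nat.cast_zero, mul_zero, add_zero]
    field_simp
    ring
  · have h1 := (hpos n).ne'
    have h2 := (hpos (n + 1)).ne'
    have e : α + β + 2 * (((n + 1 : ℕ) : ℝ) + 1) = α + β + 2 * ((n : ℝ) + 1) + 2 := by
      push_cast; ring
    rw [e] at h2
    rw [hA, hσ, hσ (n + 1), e, Nat.cast_add_one, div_sub_div _ _ h1 h2]
    congr 1
    ring
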